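/- Let $X$ be a separable, infinite-dimensional (real or complex) Banach space and let $\mathcal{B}(X)$ be the algebra of bounded linear operators on $X$. For $M \ge 1$ and $S_1,\dots,S_M \in \mathcal{B}(X)$, let $$\mathrm{s}\text{-}\mathcal{HC}(S_1,\dots,S_M) = \Bigl\{ f \in X : \{(x,\dots,x) : x \in X\} \subseteq \overline{\{(S_1^n f,\dots,S_M^n f) : n \in \mathbb{N}\}} \Bigr\},$$ where the closure is taken in the product space $X^M$ and $\mathbb{N}=\{0,1,2,\dots\}$; its elements are the simultaneously hypercyclic (s-hypercyclic) vectors of $S_1,\dots,S_M$, and $S_1,\dots,S_M$ are called s-hypercyclic if this set is nonempty. Let $N \ge 1$, let $T_1,\dots,T_N \in \mathcal{B}(X)$ be s-hypercyclic, and let $\mathcal{A} \subseteq \mathrm{s}\text{-}\mathcal{HC}(T_1,\dots,T_N)$ be a countable (possibly finite) and linearly independent set. Then $$\{ T \in \mathcal{B}(X) : \mathcal{A} \subseteq \mathrm{s}\text{-}\mathcal{HC}(T_1,\dots,T_N,T) \}$$ is dense in $\mathcal{B}(X)$ for the strong operator topology, i.e. the topology of pointwise convergence in norm on $X$. -/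

import Mathlib

/-- The set `s-HC(T₁, …, T_N)` of simultaneously hypercyclic vectors of a family of bounded
operators: the vectors `f` for which the closure, in the product topology of `X^N`, of the joint
orbit `{(T₁ⁿ f, …, T_Nⁿ f) : n ∈ ℕ}` contains the diagonal `{(x, …, x) : x ∈ X}`. -/
def sHC {𝕜 X : Type*} [NontriviallyNormedField 𝕜] [NormedAddCommGroup X] [NormedSpace 𝕜 X]
    {N : ℕ} (T : Fin N → X →L[𝕜] X) : Set X :=
  {f | Set.range (fun x : X => fun _ : Fin N => x) ⊆
    closure (Set.range (fun n : ℕ => fun i : Fin N => (T i ^ n) f))}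

/-- The operators `T₁, …, T_N` are simultaneously hypercyclic if they have an s-hypercyclic
vector. -/
def IsSHypercyclic {𝕜 X : Type*} [NontriviallyNormedField 𝕜] [NormedAddCommGroup X]
    [NormedSpace 𝕜 X] {N : ℕ} (T : Fin N → X →L[𝕜] X) : Prop :=
  (sHC T).Nonempty

/-- A set of bounded operators is SOT-dense if its image in the space of continuous linear maps
with the topology of pointwise convergence in norm (the strong operator topology) is dense. -/
def IsSOTDense {𝕜 X : Type*} [NontriviallyNormedField 𝕜] [NormedAddCommGroup X]
    [NormedSpace 𝕜 X] (S : Set (X →L[𝕜] X)) : Prop :=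
  Dense (ContinuousLinearMap.toPointwiseConvergenceCLM 𝕜 (RingHom.id 𝕜) X X '' S)

open Filter Topology Polynomial

/-! The new operator is sought in the form `L⁻¹ S L`, with one fixed mixing operator `S` and a
generic invertible `L`. Call `f` good for `L` if, for all targets `x` in a dense sequence and all
tolerances, some `n` brings every `T i ^ n f` close to `x` and `S ^ n (L f)` close to `L x`; then
`f` is s-hypercyclic for the family extended by `L⁻¹ S L`. For each `f`, target and tolerance this
condition on `L` is open in operator norm. It is also dense, since the `T i` return near `x`
infinitely often and mixing allows a rank-one correction of `L` at such a time
(`dense_exists_return_of_isMixing`). By Baire, countably many `f` are handled at once by an `L`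
arbitrarily close to any prescribed invertible operator.

It remains to start from an invertible `K₀` with `K₀ S K₀⁻¹` close to the target operator on a
finite set (`exists_conj_norm_sub_lt`), and to perturb `L` near `K₀⁻¹`. Both demands on `S`, mixing
and many linearly independent vectors `u k`, `S (u k) - u k`, hold when `S` is the translation `p(X)
↦ p(X + 1)` on a dense copy of the polynomials (`exists_clm_translation`). -/

/-! ### Biorthogonal systems with dense span -/

theorem exists_clm_eq_zero_on_and_eq_one_ne_zero {𝕜 X : Type*} [RCLike 𝕜] [NormedAddCommGroup X]
    [NormedSpace 𝕜 X] (F : Submodule 𝕜 X) [FiniteDimensional 𝕜 F] {x y : X} (hx : x ∉ F)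
    (hy : y ∉ F) : ∃ φ : X →L[𝕜] 𝕜, (∀ z ∈ F, φ z = 0) ∧ φ x = 1 ∧ φ y ≠ 0 := by
  have hF : IsClosed (F : Set X) := F.closed_of_finiteDimensional
  have key : ∀ z, z ∉ F → (F.mkQL z : X ⧸ F) ≠ 0 := fun z hz h =>
    hz ((Submodule.Quotient.mk_eq_zero F).1 h)
  obtain ⟨f, hf1, hf2⟩ := SeparatingDual.exists_eq_one_ne_zero_of_ne_zero_pair (R := 𝕜)
    (key x hx) (key y hy)
  refine ⟨f.comp F.mkQL, fun z hz => ?_, hf1, hf2⟩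
  have : (F.mkQL z : X ⧸ F) = 0 := (Submodule.Quotient.mk_eq_zero F).2 hz
  simp only [ContinuousLinearMap.comp_apply, this, map_zero]

theorem exists_linearIndependent_seq_dense_span {𝕜 X : Type*} [RCLike 𝕜] [NormedAddCommGroup X]
    [NormedSpace 𝕜 X] [TopologicalSpace.SeparableSpace X] (hX : ¬ FiniteDimensional 𝕜 X) :
    ∃ v : ℕ → X, LinearIndependent 𝕜 v ∧ Dense (Submodule.span 𝕜 (Set.range v) : Set X) := by
  obtain ⟨b, hb, hspan, hli⟩ :=
    exists_linearIndependent 𝕜 (Set.range (TopologicalSpace.denseSeq X))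
  have hd : Dense (Submodule.span 𝕜 b : Set X) := by
    rw [hspan]
    exact (TopologicalSpace.denseRange_denseSeq X).mono Submodule.subset_span
  have hinf : b.Infinite := by
    intro hfin
    have : FiniteDimensional 𝕜 (Submodule.span 𝕜 b) := FiniteDimensional.span_of_finite 𝕜 hfin
    have hc : IsClosed (Submodule.span 𝕜 b : Set X) := Submodule.closed_of_finiteDimensional _
    have htop : Submodule.span 𝕜 b = ⊤ := by
      apply SetLike.coe_injective
      rw [← hc.closure_eq, hd.closure_eq, Submodule.top_coe]
    rw [htop] at this
    exact hX (Module.finite_def.2 (Module.Finite.iff_fg.1 this))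
  have hcount : b.Countable := (Set.countable_range _).mono hb
  have : Infinite b := hinf.to_subtype
  have : Countable b := hcount.to_subtype
  obtain ⟨g⟩ := nonempty_equiv_of_countable (α := ℕ) (β := b)
  refine ⟨fun n => g n, hli.comp g g.injective, ?_⟩
  have : Set.range (fun n => (g n : X)) = b := by
    rw [show (fun n => (g n : X)) = Subtype.val ∘ g from rfl, g.surjective.range_comp,
      Subtype.range_coe]
  rwa [this]

/-- The Gram–Schmidt type recursion turning a sequence `v` into one that is biorthogonal to the
functionals `f`, provided `f k` vanishes on `v j` for `j < k` and is `1` at `v k`. -/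
noncomputable def biorthogonalize {𝕜 X : Type*} [RCLike 𝕜] [NormedAddCommGroup X]
    [NormedSpace 𝕜 X] (v : ℕ → X) (f : ℕ → X →L[𝕜] 𝕜) : ℕ → X
  | k => v k - ∑ j : Fin k, f j (v k) • biorthogonalize v f j

theorem exists_biorthogonal_seq_dense_span {𝕜 X : Type*} [RCLike 𝕜] [NormedAddCommGroup X]
    [NormedSpace 𝕜 X] [TopologicalSpace.SeparableSpace X] (hX : ¬ FiniteDimensional 𝕜 X) :
    ∃ (e : ℕ → X) (f : ℕ → X →L[𝕜] 𝕜), (∀ i j, f i (e j) = if i = j then 1 else 0) ∧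
      Dense (Submodule.span 𝕜 (Set.range e) : Set X) := by
  obtain ⟨v, hv, hd⟩ := exists_linearIndependent_seq_dense_span (𝕜 := 𝕜) hX
  have hex : ∀ k, ∃ φ : X →L[𝕜] 𝕜, (∀ z ∈ Submodule.span 𝕜 (v '' Set.Iio k), φ z = 0) ∧
      φ (v k) = 1 := by
    intro k
    have : FiniteDimensional 𝕜 (Submodule.span 𝕜 (v '' Set.Iio k)) :=
      FiniteDimensional.span_of_finite 𝕜 ((Set.finite_Iio k).image v)
    have hk : v k ∉ Submodule.span 𝕜 (v '' Set.Iio k) :=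
      hv.notMem_span_image (by simp)
    obtain ⟨φ, h1, h2, -⟩ := exists_clm_eq_zero_on_and_eq_one_ne_zero _ hk hk
    exact ⟨φ, h1, h2⟩
  choose f hf0 hf1 using hex
  set e := biorthogonalize v f with he
  have hrec : ∀ k, e k = v k - ∑ j : Fin k, f j (v k) • e j := by
    intro k
    rw [he, biorthogonalize]
  have hmem : ∀ k, e k ∈ Submodule.span 𝕜 (v '' Set.Iio (k + 1)) := by
    intro k
    induction k using Nat.strong_induction_on with
    | _ k ih =>
      rw [hrec]
      refine Submodule.sub_mem _ (Submodule.subset_span ⟨k, by simp, rfl⟩)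
        (Submodule.sum_mem _ fun j _ => Submodule.smul_mem _ _ ?_)
      refine Submodule.span_mono (Set.image_mono ?_) (ih j j.2)
      exact Set.Iio_subset_Iio (by omega)
  have hgt : ∀ i j, j < i → f i (e j) = 0 := fun i j hij =>
    hf0 i _ (Submodule.span_mono (Set.image_mono (Set.Iio_subset_Iio (by omega))) (hmem j))
  have hself : ∀ k, f k (e k) = 1 := by
    intro k
    rw [hrec, map_sub, hf1, map_sum, Finset.sum_eq_zero, sub_zero]
    intro j _
    rw [map_smul, hgt k j j.2, smul_zero]
  -- The recursion subtracts exactly `f i (v k) • e i`; the other terms vanish under `f i`, by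
  -- induction for `j > i` and by `hgt` for `j < i`.
  have hlt : ∀ k i, i < k → f i (e k) = 0 := by
    intro k
    induction k using Nat.strong_induction_on with
    | _ k ih =>
      intro i hi
      rw [hrec, map_sub, map_sum, Finset.sum_eq_single ⟨i, hi⟩]
      · simp [hself]
      · intro j _ hj
        have hne : i ≠ j := fun h => hj (Fin.ext h.symm)
        rcases lt_or_gt_of_ne hne with h | h
        · rw [map_smul, ih j j.2 i h, smul_zero]
        · rw [map_smul, hgt i j h, smul_zero]
      · simp
  refine ⟨e, f, fun i j => ?_, ?_⟩
  · split_ifs with h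
    · rw [h, hself]
    · rcases lt_or_gt_of_ne h with h | h
      · exact hlt j i h
      · exact hgt i j h
  · refine hd.mono ?_
    rw [SetLike.coe_subset_coe, Submodule.span_le]
    rintro _ ⟨k, rfl⟩
    have : v k = e k + ∑ j : Fin k, f j (v k) • e j := by rw [hrec k]; abel
    rw [this]
    exact Submodule.add_mem _ (Submodule.subset_span ⟨k, rfl⟩)
      (Submodule.sum_mem _ fun j _ => Submodule.smul_mem _ _ (Submodule.subset_span ⟨j, rfl⟩))

/-! ### The translation operator on a dense copy of the polynomials -/

/-- A rapidly growing sequence: `rapidScale c k` dominates `2 ^ k` times the combination of its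
predecessors with coefficients `c k`. -/
noncomputable def rapidScale (c : ℕ → ℕ → ℝ) : ℕ → ℝ
  | k => 1 + 2 ^ k * ∑ j : Fin k, c k j * rapidScale c j

theorem rapidScale_eq (c : ℕ → ℕ → ℝ) (k : ℕ) :
    rapidScale c k = 1 + 2 ^ k * ∑ j ∈ Finset.range k, c k j * rapidScale c j := by
  rw [rapidScale, Finset.sum_range]

theorem one_le_rapidScale {c : ℕ → ℕ → ℝ} (hc : ∀ k j, 0 ≤ c k j) (k : ℕ) :
    1 ≤ rapidScale c k := by
  induction k using Nat.strong_induction_on with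
  | _ k ih =>
    rw [rapidScale_eq]
    have : 0 ≤ ∑ j ∈ Finset.range k, c k j * rapidScale c j :=
      Finset.sum_nonneg fun j hj =>
        mul_nonneg (hc k j) (zero_le_one.trans (ih j (Finset.mem_range.1 hj)))
    have := mul_nonneg (pow_nonneg (zero_le_two (α := ℝ)) k) this
    linarith

/-- On a separable infinite-dimensional Banach space there is a bounded operator that acts on a
dense copy of `𝕜[X]` as the translation `p(X) ↦ p(X + 1)`. -/
theorem exists_clm_translation {𝕜 X : Type*} [RCLike 𝕜] [NormedAddCommGroup X]
    [NormedSpace 𝕜 X] [CompleteSpace X] [TopologicalSpace.SeparableSpace X]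
    (hX : ¬ FiniteDimensional 𝕜 X) :
    ∃ (Φ : 𝕜[X] →ₗ[𝕜] X) (S : X →L[𝕜] X), Function.Injective Φ ∧ DenseRange Φ ∧
      ∀ p, S (Φ p) = Φ (p.comp (Polynomial.X + 1)) := by
  obtain ⟨e, f, hef, hd⟩ := exists_biorthogonal_seq_dense_span (𝕜 := 𝕜) hX
  set c : ℕ → ℕ → ℝ := fun k j => ‖f k‖ * (k.choose j * ‖e j‖) with hc
  have hc0 : ∀ k j, 0 ≤ c k j := fun k j => by positivity
  set d := rapidScale c with hd'
  have hd1 : ∀ k, 1 ≤ d k := one_le_rapidScale hc0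
  have hdpos : ∀ k, 0 < d k := fun k => zero_lt_one.trans_le (hd1 k)
  have hdne : ∀ k, (d k : 𝕜) ≠ 0 := fun k => by exact_mod_cast (hdpos k).ne'
  set b : ℕ → X := fun k => (d k : 𝕜) • e k with hb
  -- With `b k` standing for `X ^ k`, `u k` represents `(X + 1) ^ k - X ^ k`. Only indices below `k`
  -- occur, so a large scale `d k` makes the rank-one operator `g k ⊗ u k` small.
  set u : ℕ → X := fun k => ∑ j ∈ Finset.range k, (k.choose j : 𝕜) • b j with hu
  set g : ℕ → X →L[𝕜] 𝕜 := fun k => ((d k : 𝕜)⁻¹) • f k with hg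
  have hgb : ∀ i j, g i (b j) = if i = j then 1 else 0 := by
    intro i j
    simp only [hg, hb, smul_apply, map_smul, hef, smul_eq_mul]
    split_ifs with h
    · subst h; simp [hdne]
    · simp
  have hnorm : ∀ k, ‖(g k).smulRight (u k)‖ ≤ (1 / 2) ^ k := by
    intro k
    have h1 : ‖u k‖ ≤ ∑ j ∈ Finset.range k, (k.choose j : ℝ) * (d j * ‖e j‖) := by
      refine (norm_sum_le _ _).trans_eq (Finset.sum_congr rfl fun j _ => ?_)
      simp [hb, norm_smul, abs_of_pos (hdpos j)]
    have h2 : ‖g k‖ = (d k)⁻¹ * ‖f k‖ := by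
      simp [hg, norm_smul, abs_of_pos (hdpos k)]
    have h3 := rapidScale_eq c k
    rw [← hd'] at h3
    have h4 : ‖f k‖ * ∑ j ∈ Finset.range k, (k.choose j : ℝ) * (d j * ‖e j‖) =
        ∑ j ∈ Finset.range k, c k j * d j := by
      rw [Finset.mul_sum]
      exact Finset.sum_congr rfl fun j _ => by simp only [hc]; ring
    rw [ContinuousLinearMap.norm_smulRight_apply, h2]
    calc (d k)⁻¹ * ‖f k‖ * ‖u k‖
        ≤ (d k)⁻¹ * ‖f k‖ * ∑ j ∈ Finset.range k, (k.choose j : ℝ) * (d j * ‖e j‖) := by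
          have := (hdpos k).le
          gcongr
      _ = (d k)⁻¹ * ∑ j ∈ Finset.range k, c k j * d j := by rw [mul_assoc, h4]
      _ ≤ (1 / 2) ^ k := by
          rw [inv_mul_le_iff₀ (hdpos k), h3]
          have : (2 : ℝ) ^ k * (1 / 2) ^ k = 1 := by rw [← mul_pow]; norm_num
          have h5 : (0 : ℝ) < (1 / 2) ^ k := by positivity
          rw [add_mul, mul_right_comm, this]
          linarith
  have hsum : Summable fun k => (g k).smulRight (u k) :=
    Summable.of_norm_bounded summable_geometric_two hnorm
  set Φ : 𝕜[X] →ₗ[𝕜] X := Polynomial.lsum fun k => LinearMap.toSpanSingleton 𝕜 X (b k) with hΦ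
  have hΦm : ∀ k, Φ (Polynomial.X ^ k) = b k := by
    intro k
    rw [hΦ, Polynomial.lsum_apply, ← Polynomial.monomial_one_right_eq_X_pow]
    simp [Polynomial.sum_monomial_index]
  have hgΦ : ∀ k p, g k (Φ p) = p.coeff k := by
    intro k p
    induction p using Polynomial.induction_on' with
    | add p q hp hq => simp [hp, hq]
    | monomial n a =>
      rw [← Polynomial.C_mul_X_pow_eq_monomial, ← Polynomial.smul_eq_C_mul, map_smul, hΦm,
        map_smul, hgb, Polynomial.coeff_smul, Polynomial.coeff_X_pow]
  refine ⟨Φ, ContinuousLinearMap.id 𝕜 X + ∑' k, (g k).smulRight (u k), ?_, ?_, ?_⟩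
  · intro p q hpq
    ext k
    rw [← hgΦ, ← hgΦ, hpq]
  · refine hd.mono ?_
    have : (Set.range Φ) = (LinearMap.range Φ : Set X) := rfl
    rw [this, SetLike.coe_subset_coe, Submodule.span_le]
    rintro _ ⟨k, rfl⟩
    refine ⟨(d k : 𝕜)⁻¹ • Polynomial.X ^ k, ?_⟩
    rw [map_smul, hΦm, hb]
    simp [smul_smul, hdne]
  · intro p
    have hS : ∀ k, (∑' k, (g k).smulRight (u k)) (b k) = u k := by
      intro k
      have h := hsum.hasSum.mapL (ContinuousLinearMap.apply 𝕜 X (b k))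
      refine h.unique ?_
      convert hasSum_single k ?_ using 1
      · simp [hgb]
      · intro j hj
        simp [hgb, hj]
    induction p using Polynomial.induction_on' with
    | add p q hp hq => simp only [map_add, hp, hq, Polynomial.add_comp]
    | monomial n a =>
      rw [← Polynomial.C_mul_X_pow_eq_monomial, ← Polynomial.smul_eq_C_mul, map_smul, map_smul,
        Polynomial.smul_comp, map_smul, Polynomial.X_pow_comp, hΦm, add_apply,
        hS, add_pow, map_sum, Finset.sum_range_succ, add_comm]
      congr 1
      simp only [one_pow, mul_one, Nat.choose_self, Nat.cast_one, hΦm,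
        ContinuousLinearMap.id_apply, hu]
      congr 1
      refine Finset.sum_congr rfl fun j _ => ?_
      rw [← Polynomial.C_eq_natCast, mul_comm, ← Polynomial.smul_eq_C_mul, map_smul, hΦm]

/-! ### Mixing of the translation operator -/

/-- A bounded operator is topologically mixing. -/
def IsMixing {𝕜 X : Type*} [NontriviallyNormedField 𝕜] [NormedAddCommGroup X] [NormedSpace 𝕜 X]
    (S : X →L[𝕜] X) : Prop :=
  ∀ u v : X, ∀ ε > 0, ∀ᶠ n in atTop, ∃ w, ‖w - u‖ < ε ∧ ‖(S ^ n) w - v‖ < ε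

/-- The pairs `(u, v)` for which some sequence `w n → u` has `S ^ n (w n) → v`. -/
def mixingPairs {𝕜 X : Type*} [NontriviallyNormedField 𝕜] [NormedAddCommGroup X] [NormedSpace 𝕜 X]
    (S : X →L[𝕜] X) : Submodule 𝕜 (X × X) where
  carrier := {z | ∃ w : ℕ → X, Tendsto w atTop (𝓝 z.1) ∧
    Tendsto (fun n => (S ^ n) (w n)) atTop (𝓝 z.2)}
  zero_mem' := ⟨0, tendsto_const_nhds, by simp⟩
  add_mem' := by
    rintro a b ⟨w, h1, h2⟩ ⟨w', h1', h2'⟩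
    exact ⟨w + w', h1.add h1', by simpa using h2.add h2'⟩
  smul_mem' := by
    rintro c a ⟨w, h1, h2⟩
    exact ⟨c • w, h1.const_smul c, by simpa using h2.const_smul c⟩

theorem isMixing_of_dense_mixingPairs {𝕜 X : Type*} [NontriviallyNormedField 𝕜]
    [NormedAddCommGroup X] [NormedSpace 𝕜 X] {S : X →L[𝕜] X}
    (h : Dense (mixingPairs S : Set (X × X))) : IsMixing S := by
  intro u v ε hε
  obtain ⟨⟨a, b⟩, ⟨w, hw1, hw2⟩, hab⟩ := Metric.dense_iff.1 h (u, v) ε hε |>.imp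
    fun _ h => And.symm h
  rw [Metric.mem_ball, Prod.dist_eq, max_lt_iff] at hab
  have h1 := hw1 (Metric.isOpen_ball.mem_nhds (Metric.mem_ball.2 hab.1))
  have h2 := hw2 (Metric.isOpen_ball.mem_nhds (Metric.mem_ball.2 hab.2))
  filter_upwards [h1, h2] with n hn1 hn2
  exact ⟨w n, by simpa [dist_eq_norm] using hn1, by simpa [dist_eq_norm] using hn2⟩

theorem tendsto_pow_mul_inv_pow_of_lt (𝕜 : Type*) [RCLike 𝕜] {i m : ℕ} (h : i < m) :
    Tendsto (fun n : ℕ => (n : 𝕜) ^ i * ((n : 𝕜)⁻¹) ^ m) atTop (𝓝 0) := by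
  obtain ⟨k, rfl⟩ := Nat.exists_eq_add_of_lt h
  have h1 : Tendsto (fun n : ℕ => ((n : 𝕜)⁻¹) ^ (k + 1)) atTop (𝓝 0) := by
    simpa using (tendsto_inv_atTop_nhds_zero_nat (𝕜 := 𝕜)).pow (k + 1)
  refine h1.congr' ?_
  filter_upwards [eventually_ne_atTop 0] with n hn
  have : (n : 𝕜) ≠ 0 := Nat.cast_ne_zero.2 hn
  rw [add_assoc, pow_add _ i, ← mul_assoc, ← mul_pow, mul_inv_cancel₀ this, one_pow, one_mul]

/-- Each monomial of `q` has degree `m > i` and is scaled by `n ^ (i - m) → 0`. There are finitely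
many of them, so no continuity of `Φ` is needed. -/
theorem tendsto_rescale_of_dvd {𝕜 X : Type*} [RCLike 𝕜] [NormedAddCommGroup X]
    [NormedSpace 𝕜 X] (Φ : 𝕜[X] →ₗ[𝕜] X) {i : ℕ} {q : 𝕜[X]} (hq : Polynomial.X ^ (i + 1) ∣ q) :
    Tendsto (fun n : ℕ => Φ ((n : 𝕜) ^ i • q.comp (C ((n : 𝕜)⁻¹) * Polynomial.X))) atTop (𝓝 0) := by
  obtain ⟨s, rfl⟩ := hq
  induction s using Polynomial.induction_on' with
  | add p q hp hq => simpa [mul_add, smul_add] using hp.add hq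
  | monomial k a =>
    have h := (tendsto_pow_mul_inv_pow_of_lt 𝕜 (show i < i + 1 + k by omega)).smul_const
      (Φ (C a * Polynomial.X ^ (i + 1 + k)))
    rw [zero_smul] at h
    refine h.congr fun n => ?_
    rw [← map_smul]
    congr 1
    rw [← C_mul_X_pow_eq_monomial]
    simp only [mul_comp, pow_comp, X_comp, C_comp, smul_eq_C_mul, mul_pow, map_mul, map_pow]
    ring

theorem tendsto_rescale_of_dvd_sub {𝕜 X : Type*} [RCLike 𝕜] [NormedAddCommGroup X]
    [NormedSpace 𝕜 X] (Φ : 𝕜[X] →ₗ[𝕜] X) {i : ℕ} {q : 𝕜[X]}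
    (hq : Polynomial.X ^ (i + 1) ∣ q - Polynomial.X ^ i) :
    Tendsto (fun n : ℕ => Φ ((n : 𝕜) ^ i • q.comp (C ((n : 𝕜)⁻¹) * Polynomial.X))) atTop
      (𝓝 (Φ (Polynomial.X ^ i))) := by
  have h := (tendsto_rescale_of_dvd Φ hq).add_const (Φ (Polynomial.X ^ i))
  rw [zero_add] at h
  refine h.congr' ?_
  filter_upwards [eventually_ne_atTop 0] with n hn
  have hn' : (n : 𝕜) ≠ 0 := Nat.cast_ne_zero.2 hn
  rw [← map_add]
  congr 1
  have hX : (n : 𝕜) ^ i • (C ((n : 𝕜)⁻¹) * Polynomial.X) ^ i = (Polynomial.X ^ i : 𝕜[X]) := by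
    rw [mul_pow, ← C_pow, smul_eq_C_mul, ← mul_assoc, ← C_mul, ← mul_pow, mul_inv_cancel₀ hn',
      one_pow, C_1, one_mul]
  rw [sub_comp, smul_sub, X_pow_comp, hX, sub_add_cancel]

/-- A Bézout relation between the coprime `X ^ m` and `(X - 1) ^ m` gives a polynomial step: flat
value 0 at the point 0 and flat value 1 at the point 1. -/
theorem exists_polynomial_step (𝕜 : Type*) [Field 𝕜] (m : ℕ) :
    ∃ h : 𝕜[X], X ^ m ∣ h ∧ X ^ m ∣ h.comp (X + 1) - 1 := by
  have hco : IsCoprime (X : 𝕜[X]) (X - 1) := ⟨1, -1, by ring⟩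
  obtain ⟨a, b, hab⟩ := hco.pow (m := m) (n := m)
  refine ⟨a * X ^ m, dvd_mul_left _ _, ?_⟩
  have h := congrArg (fun p => p.comp (X + 1)) hab
  simp only [add_comp, mul_comp, pow_comp, X_comp, sub_comp, one_comp, add_sub_cancel_right] at h
  refine ⟨-(b.comp (X + 1)), ?_⟩
  simp only [mul_comp, pow_comp, X_comp]
  linear_combination h

theorem pow_apply_translation {𝕜 X : Type*} [RCLike 𝕜] [NormedAddCommGroup X]
    [NormedSpace 𝕜 X] {Φ : 𝕜[X] →ₗ[𝕜] X} {S : X →L[𝕜] X}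
    (hS : ∀ p, S (Φ p) = Φ (p.comp (Polynomial.X + 1))) (n : ℕ) (p : 𝕜[X]) :
    (S ^ n) (Φ p) = Φ (p.comp (Polynomial.X + (n : 𝕜[X]))) := by
  induction n generalizing p with
  | zero => simp
  | succ n ih =>
    rw [pow_succ, mul_apply_eq_comp, hS, ih, comp_assoc]
    congr 2
    simp only [add_comp, X_comp, one_comp]
    push_cast
    ring

/-- Under the dilation `X ↦ X / n`, translation by `n` becomes translation by 1. So `w n = n ^ i q(X
/ n)` has limit governed by `q` near 0, while that of `S ^ n (w n)` is governed by `q` near 1, and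
the step polynomial prescribes these two germs independently. -/
theorem isMixing_of_translation {𝕜 X : Type*} [RCLike 𝕜] [NormedAddCommGroup X]
    [NormedSpace 𝕜 X] {Φ : 𝕜[X] →ₗ[𝕜] X} {S : X →L[𝕜] X} (hΦ : DenseRange Φ)
    (hS : ∀ p, S (Φ p) = Φ (p.comp (Polynomial.X + 1))) : IsMixing S := by
  have hpow : ∀ (i : ℕ) (q : 𝕜[X]), ∀ᶠ n : ℕ in atTop,
      Φ ((n : 𝕜) ^ i • (q.comp (Polynomial.X + 1)).comp (C ((n : 𝕜)⁻¹) * Polynomial.X)) =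
      (S ^ n) (Φ ((n : 𝕜) ^ i • q.comp (C ((n : 𝕜)⁻¹) * Polynomial.X))) := by
    intro i q
    filter_upwards [eventually_ne_atTop 0] with n hn
    have hn' : (n : 𝕜) ≠ 0 := Nat.cast_ne_zero.2 hn
    rw [pow_apply_translation hS, smul_comp, comp_assoc, comp_assoc]
    congr 3
    simp only [add_comp, mul_comp, X_comp, C_comp, one_comp, mul_add]
    rw [← C_eq_natCast, ← C_mul, inv_mul_cancel₀ hn', C_1]
  have hmono : ∀ i, (Φ (Polynomial.X ^ i), (0 : X)) ∈ mixingPairs S ∧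
      ((0 : X), Φ (Polynomial.X ^ i)) ∈ mixingPairs S := by
    intro i
    obtain ⟨h, h0, h1⟩ := exists_polynomial_step 𝕜 (i + 1)
    constructor
    -- This `q` agrees with `X ^ i` to order `i + 1` at 0 and vanishes to that order at 1. The
    -- second choice, `h * (X - 1) ^ i`, exchanges the two roles.
    · refine ⟨_, tendsto_rescale_of_dvd_sub Φ (q := Polynomial.X ^ i * (1 - h)) ?_,
        (tendsto_rescale_of_dvd Φ ?_).congr' (hpow i _)⟩
      · rw [show Polynomial.X ^ i * (1 - h) - Polynomial.X ^ i = -Polynomial.X ^ i * h by ring]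
        exact h0.mul_left _
      · rw [mul_comp, sub_comp, one_comp, ← neg_sub]
        exact (h1.neg_right).mul_left _
    · refine ⟨_, tendsto_rescale_of_dvd Φ (q := h * (Polynomial.X - 1) ^ i) (h0.mul_right _),
        (tendsto_rescale_of_dvd_sub Φ ?_).congr' (hpow i _)⟩
      simp only [mul_comp, pow_comp, sub_comp, X_comp, one_comp, add_sub_cancel_right]
      rw [show h.comp (Polynomial.X + 1) * Polynomial.X ^ i - Polynomial.X ^ i =
        (h.comp (Polynomial.X + 1) - 1) * Polynomial.X ^ i by ring]
      exact h1.mul_right _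
  have hall : ∀ p, (Φ p, (0 : X)) ∈ mixingPairs S ∧ ((0 : X), Φ p) ∈ mixingPairs S := by
    intro p
    induction p using Polynomial.induction_on' with
    | add p q hp hq =>
      exact ⟨by simpa using (mixingPairs S).add_mem hp.1 hq.1,
        by simpa using (mixingPairs S).add_mem hp.2 hq.2⟩
    | monomial n a =>
      rw [← C_mul_X_pow_eq_monomial, ← smul_eq_C_mul, map_smul]
      exact ⟨by simpa using (mixingPairs S).smul_mem a (hmono n).1,
        by simpa using (mixingPairs S).smul_mem a (hmono n).2⟩
  refine isMixing_of_dense_mixingPairs ((hΦ.prodMap hΦ).mono ?_)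
  rintro _ ⟨⟨p, q⟩, rfl⟩
  simpa using (mixingPairs S).add_mem (hall p).1 (hall q).2

/-! ### Strong operator density of the similarity orbit -/

/-- The forward difference lowers degree by exactly one, so the odd powers of `X` and their
differences have pairwise distinct degrees. -/
theorem linearIndependent_fwdDiff_translation {𝕜 X : Type*} [RCLike 𝕜] [NormedAddCommGroup X]
    [NormedSpace 𝕜 X] {Φ : 𝕜[X] →ₗ[𝕜] X} {S : X →L[𝕜] X} (hΦ : Function.Injective Φ)
    (hS : ∀ p, S (Φ p) = Φ (p.comp (Polynomial.X + 1))) :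
    ∃ u : ℕ → X, LinearIndependent 𝕜 (Sum.elim u fun k => S (u k) - u k) := by
  have hdeg : ∀ n : ℕ, ((Polynomial.X + 1) ^ (n + 1) - Polynomial.X ^ (n + 1) : 𝕜[X]).degree = n := by
    intro n
    apply degree_eq_of_le_of_coeff_ne_zero
    · rw [degree_le_iff_coeff_zero]
      intro m hm
      have hm' : n < m := by exact_mod_cast hm
      rw [coeff_sub, coeff_X_add_one_pow, coeff_X_pow]
      split_ifs with h
      · simp [h]
      · rw [Nat.choose_eq_zero_of_lt (by omega)]; simp
    · rw [coeff_sub, coeff_X_add_one_pow, coeff_X_pow, if_neg (by omega), sub_zero,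
        Nat.choose_succ_self_right]
      exact_mod_cast Nat.succ_ne_zero n
  let Q : Polynomial.Sequence 𝕜 :=
    { elems' := fun k => if Even k then (Polynomial.X + 1) ^ (k + 1) - Polynomial.X ^ (k + 1)
        else Polynomial.X ^ k
      degree_eq' := fun k => by
        split_ifs
        · exact hdeg k
        · exact degree_X_pow k }
  have hli : LinearIndependent 𝕜 (fun k => Φ (Q k)) :=
    Q.linearIndependent.map' Φ (LinearMap.ker_eq_bot.2 hΦ)
  let σ : ℕ ⊕ ℕ → ℕ := Sum.elim (fun k => 2 * k + 1) (fun k => 2 * k)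
  have hσ : Function.Injective σ := by
    rintro (a | a) (b | b) h <;> simp only [σ, Sum.elim_inl, Sum.elim_inr] at h
    · congr 1; omega
    · omega
    · omega
    · congr 1; omega
  refine ⟨fun k => Φ (Polynomial.X ^ (2 * k + 1)), ?_⟩
  convert hli.comp σ hσ using 1
  ext (k | k)
  · change _ = Φ (if Even (2 * k + 1) then _ else _)
    rw [if_neg (by simp)]
    rfl
  · change S _ - _ = Φ (if Even (2 * k) then _ else _)
    rw [if_pos (by simp), hS, ← map_sub, X_pow_comp]
    rfl

theorem exists_unit_eq_id_on_and_apply_eq {𝕜 X : Type*} [RCLike 𝕜] [NormedAddCommGroup X]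
    [NormedSpace 𝕜 X] (F : Submodule 𝕜 X) [FiniteDimensional 𝕜 F] {x y : X} (hx : x ∉ F)
    (hy : y ∉ F) : ∃ M : (X →L[𝕜] X)ˣ, (∀ z ∈ F, (M : X →L[𝕜] X) z = z) ∧
      (M : X →L[𝕜] X) x = y := by
  obtain ⟨φ, h0, h1, hne⟩ := exists_clm_eq_zero_on_and_eq_one_ne_zero F hx hy
  -- A rank-one perturbation of the identity, invertible because `1 + φ (y - x) = φ y ≠ 0`.
  refine ⟨⟨1 + φ.smulRight (y - x), 1 - (φ y)⁻¹ • φ.smulRight (y - x), ?_, ?_⟩, fun z hz => ?_, ?_⟩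
  · ext z
    simp only [mul_apply_eq_comp, add_apply, sub_apply, smul_apply,
      one_apply_eq_self, ContinuousLinearMap.smulRight_apply, map_sub, map_smul, h1,
      smul_smul]
    match_scalars <;> field_simp <;> ring
  · ext z
    simp only [mul_apply_eq_comp, add_apply, sub_apply, smul_apply,
      one_apply_eq_self, ContinuousLinearMap.smulRight_apply, map_add, map_sub,
      map_smul, h1, smul_smul]
    match_scalars <;> field_simp <;> ring
  · simp [h0 z hz]
  · simp [h1]

/-- Invertible operators move a linearly independent sequence into sets `U i` that can be
entered independently of the previous choices. -/
theorem exists_unit_apply_mem {𝕜 X : Type*} [RCLike 𝕜] [NormedAddCommGroup X]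
    [NormedSpace 𝕜 X] {a : ℕ → X} (ha : LinearIndependent 𝕜 a) {U : ℕ → Set X}
    (hU : ∀ (n : ℕ) (x : ℕ → X), (∀ j < n, x j ∈ U j) →
      ∃ y ∈ U n, y ∉ Submodule.span 𝕜 (x '' Set.Iio n)) (n : ℕ) :
    ∃ K : (X →L[𝕜] X)ˣ, ∀ i < n, (K : X →L[𝕜] X) (a i) ∈ U i := by
  induction n with
  | zero => exact ⟨1, by simp⟩
  | succ n ih =>
    obtain ⟨K, hK⟩ := ih
    have hinj : Function.Injective (K : X →L[𝕜] X) := by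
      intro p q hpq
      have := congrArg (((K⁻¹ : (X →L[𝕜] X)ˣ) : X →L[𝕜] X)) hpq
      simpa [← mul_apply_eq_comp] using this
    obtain ⟨y, hyU, hy⟩ := hU n (fun i => (K : X →L[𝕜] X) (a i)) hK
    have hli : LinearIndependent 𝕜 fun i => (K : X →L[𝕜] X) (a i) :=
      ha.map' (K : X →L[𝕜] X).toLinearMap (LinearMap.ker_eq_bot.2 hinj)
    have : FiniteDimensional 𝕜
        (Submodule.span 𝕜 ((fun i => (K : X →L[𝕜] X) (a i)) '' Set.Iio n)) :=
      FiniteDimensional.span_of_finite 𝕜 ((Set.finite_Iio n).image _)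
    obtain ⟨M, hM, hMx⟩ := exists_unit_eq_id_on_and_apply_eq _
      (hli.notMem_span_image (s := Set.Iio n) (x := n) (by simp)) hy
    refine ⟨M * K, fun i hi => ?_⟩
    rw [Units.val_mul, mul_apply_eq_comp]
    rcases Nat.lt_succ_iff_lt_or_eq.1 hi with h | rfl
    · rw [hM _ (Submodule.subset_span ⟨i, h, rfl⟩)]
      exact hK i h
    · rwa [hMx]

theorem eventually_norm_apply_lt_of_mem_span {𝕜 X : Type*} [RCLike 𝕜] [NormedAddCommGroup X]
    [NormedSpace 𝕜 X] {b : Set X} {x : X} (hx : x ∈ Submodule.span 𝕜 b) :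
    ∀ ε > 0, ∀ᶠ δ in 𝓝[>] (0 : ℝ), ∀ D : X →L[𝕜] X, (∀ v ∈ b, ‖D v‖ < δ) → ‖D x‖ < ε := by
  induction hx using Submodule.span_induction with
  | mem x h =>
    intro ε hε
    filter_upwards [Ioo_mem_nhdsGT hε] with δ hδ D hD
    exact (hD x h).trans hδ.2
  | zero => exact fun ε hε => Eventually.of_forall fun δ D _ => by simpa using hε
  | add x y _ _ hx hy =>
    intro ε hε
    filter_upwards [hx (ε / 2) (half_pos hε), hy (ε / 2) (half_pos hε)] with δ h1 h2 D hD
    rw [map_add]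
    linarith [norm_add_le (D x) (D y), h1 D hD, h2 D hD]
  | smul a x _ hx =>
    intro ε hε
    have ha : 0 < ‖a‖ + 1 := by positivity
    filter_upwards [hx (ε / (‖a‖ + 1)) (by positivity)] with δ h1 D hD
    rw [map_smul, norm_smul]
    have h2 := (lt_div_iff₀ ha).1 (h1 D hD)
    nlinarith [norm_nonneg (D x)]

theorem exists_mem_ball_notMem_span_finite {𝕜 X : Type*} [RCLike 𝕜] [NormedAddCommGroup X]
    [NormedSpace 𝕜 X] (hX : ¬ FiniteDimensional 𝕜 X) {s : Set X} (hs : s.Finite) (x : X) {δ : ℝ}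
    (hδ : 0 < δ) : ∃ y ∈ Metric.ball x δ, y ∉ Submodule.span 𝕜 s := by
  by_contra! h
  have htop : Submodule.span 𝕜 s = ⊤ := by
    apply Submodule.eq_top_of_nonempty_interior'
    exact ⟨x, mem_interior.2 ⟨_, h, Metric.isOpen_ball, Metric.mem_ball_self hδ⟩⟩
  exact hX ⟨⟨hs.toFinset, by simpa using htop⟩⟩

/-- The similarity orbit of an operator with enough linearly independent increments is dense in the
strong operator topology. -/
theorem exists_conj_norm_sub_lt {𝕜 X : Type*} [RCLike 𝕜] [NormedAddCommGroup X]
    [NormedSpace 𝕜 X] (hX : ¬ FiniteDimensional 𝕜 X) {S : X →L[𝕜] X} {u : ℕ → X}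
    (hu : LinearIndependent 𝕜 (Sum.elim u fun k => S (u k) - u k)) (R : X →L[𝕜] X) {F : Set X}
    (hF : F.Finite) {ε : ℝ} (hε : 0 < ε) :
    ∃ K : (X →L[𝕜] X)ˣ, ∀ x ∈ F, ‖((K : X →L[𝕜] X) * S * (K⁻¹ : (X →L[𝕜] X)ˣ)) x - R x‖ < ε := by
  obtain ⟨b, hbF, hspan, hli⟩ := exists_linearIndependent 𝕜 F
  have hbfin : b.Finite := hF.subset hbF
  obtain ⟨r, y, hyinj, hyb⟩ := hbfin.fin_param
  have hy : LinearIndependent 𝕜 y :=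
    hli.comp (fun i => (⟨y i, hyb ▸ Set.mem_range_self i⟩ : b))
      fun i j hij => hyinj (Subtype.ext_iff.1 hij)
  have hev : ∀ᶠ δ in 𝓝[>] (0 : ℝ), ∀ x ∈ F, ∀ D : X →L[𝕜] X, (∀ v ∈ b, ‖D v‖ < δ) → ‖D x‖ < ε :=
    (eventually_all_finite hF).2 fun x hx =>
      eventually_norm_apply_lt_of_mem_span (hspan ▸ Submodule.subset_span hx) ε hε
  obtain ⟨δ, hδ, hδ0 : 0 < δ⟩ := (hev.and self_mem_nhdsWithin).exists
  let y' : ℕ → X := fun i => if h : i < r then y ⟨i, h⟩ else 0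
  have hy' : ∀ i : Fin r, y' i = y i := fun i => by simp [y']
  -- The first `r` conditions force `K (u i) = y i` exactly; the next `r` put `K (S (u i) - u i)`
  -- within `δ` of `R (y i) - y i`. Adding the two, `K S K⁻¹` is within `δ` of `R` at each `y i`.
  let U : ℕ → Set X := fun i =>
    if i < r then {y' i} else Metric.ball (R (y' (i - r)) - y' (i - r)) δ
  let σ : ℕ → ℕ ⊕ ℕ := fun i => if i < r then Sum.inl i else Sum.inr (i - r)
  have hσ : Function.Injective σ := by
    intro i j hij
    simp only [σ] at hij
    split_ifs at hij with h1 h2 h2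
    · exact Sum.inl_injective hij
    · have := Sum.inr_injective hij; omega
  obtain ⟨K, hK⟩ := exists_unit_apply_mem (hu.comp σ hσ) (U := U) (fun n x hx => by
    by_cases hn : n < r
    · refine ⟨y' n, by simp [U, hn], fun hmem => ?_⟩
      refine hy.notMem_span_image (s := Set.Iio ⟨n, hn⟩) (x := ⟨n, hn⟩) (by simp) ?_
      rw [← hy' ⟨n, hn⟩]
      refine Submodule.span_mono ?_ hmem
      rintro _ ⟨j, hj, rfl⟩
      have hj' : j < n := hj
      have := hx j hj'
      simp only [U, if_pos (hj'.trans hn), Set.mem_singleton_iff] at this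
      exact ⟨⟨j, hj'.trans hn⟩, hj', by rw [this, ← hy']⟩
    · simp only [U, if_neg hn]
      exact exists_mem_ball_notMem_span_finite hX ((Set.finite_Iio n).image x) _ hδ0) (r + r)
  refine ⟨K, fun x hx => ?_⟩
  refine hδ x hx ((K : X →L[𝕜] X) * S * (K⁻¹ : (X →L[𝕜] X)ˣ) - R) fun v hv => ?_
  obtain ⟨i, rfl⟩ := (hyb ▸ hv : v ∈ Set.range y)
  have h1 : (K : X →L[𝕜] X) (u i) = y i := by
    simpa [U, σ, hy'] using hK i (by omega)
  have h2 : (K : X →L[𝕜] X) (S (u i) - u i) ∈ Metric.ball (R (y i) - y i) δ := by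
    simpa [U, σ, hy'] using hK (r + i) (by omega)
  have h3 : ((K⁻¹ : (X →L[𝕜] X)ˣ) : X →L[𝕜] X) (y i) = u i := by
    rw [← h1, ← mul_apply_eq_comp, Units.inv_mul,
      one_apply_eq_self]
  rw [sub_apply, mul_apply_eq_comp, mul_apply_eq_comp, h3]
  rw [Metric.mem_ball, dist_eq_norm, map_sub, h1] at h2
  rwa [sub_sub_sub_cancel_right] at h2

/-! ### The Baire category argument -/

theorem sHC_frequently_return {𝕜 X : Type*} [RCLike 𝕜] [NormedAddCommGroup X]
    [NormedSpace 𝕜 X] [Nontrivial X] {N : ℕ} (hN : 1 ≤ N) {T : Fin N → X →L[𝕜] X} {f : X}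
    (hf : f ∈ sHC T) (x : X) {ε : ℝ} (hε : 0 < ε) :
    ∃ᶠ n in atTop, ∀ i, ‖(T i ^ n) f - x‖ < ε := by
  rw [frequently_atTop]
  intro N₀
  set o : ℕ → Fin N → X := fun n i => (T i ^ n) f with ho
  have hfin : (o '' Set.Iio N₀).Finite := (Set.finite_Iio N₀).image o
  have : Nonempty (Fin N) := ⟨⟨0, hN⟩⟩
  have hinj : Function.Injective fun (y : X) (_ : Fin N) => y := Function.const_injective
  have : (𝓝[≠] x).NeBot := Module.punctured_nhds_neBot 𝕜 X x
  have hball : (Metric.ball x ε).Infinite := infinite_of_mem_nhds x (Metric.ball_mem_nhds x hε)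
  -- Replacing `x` by a nearby `y` whose diagonal point misses the first `N₀` joint orbit points
  -- forces the approximating time to be at least `N₀`.
  obtain ⟨y, hyb, hy⟩ := hball.exists_notMem_finite (hfin.preimage hinj.injOn)
  have hyc : (fun _ : Fin N => y) ∈ closure (Set.range o) := hf ⟨y, rfl⟩
  have hopen : IsOpen (Metric.ball (fun _ : Fin N => x) ε ∩ (o '' Set.Iio N₀)ᶜ) :=
    Metric.isOpen_ball.inter hfin.isClosed.isOpen_compl
  obtain ⟨_, ⟨h1, h2⟩, n, rfl⟩ := mem_closure_iff.1 hyc _ hopen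
    ⟨(dist_pi_lt_iff hε).2 fun _ => hyb, hy⟩
  refine ⟨n, ?_, fun i => ?_⟩
  · by_contra! h
    exact h2 ⟨n, h, rfl⟩
  · rw [← dist_eq_norm]
    exact (dist_pi_lt_iff hε).1 h1 i

/-- Mixing at a late time satisfying `P` gives `w` near `L f` with `S ^ n w` near `L x`. With `φ f =
1`, adding `φ ⊗ (w - L f)` to `L` sends `f` to `w` and moves `L x` only slightly. -/
theorem dense_exists_return_of_isMixing {𝕜 X : Type*} [RCLike 𝕜] [NormedAddCommGroup X]
    [NormedSpace 𝕜 X] {S : X →L[𝕜] X} (hS : IsMixing S) {P : ℕ → Prop} (hP : ∃ᶠ n in atTop, P n)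
    {f : X} (hf : f ≠ 0) (x : X) {ε : ℝ} (hε : 0 < ε) :
    Dense {L : X →L[𝕜] X | ∃ n, P n ∧ ‖(S ^ n) (L f) - L x‖ < ε} := by
  rw [Metric.dense_iff]
  intro L r hr
  obtain ⟨φ, hφ⟩ := SeparatingDual.exists_eq_one (R := 𝕜) hf
  set c := ‖φ‖ + ‖φ x‖ + 1 with hc
  have hc0 : 0 < c := by positivity
  set η := min (r / c) (ε / (2 * c)) with hη
  have hη0 : 0 < η := by positivity
  have hη1 : η * c ≤ r := (le_div_iff₀ hc0).1 (min_le_left _ _)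
  have hη2 : η * (2 * c) ≤ ε := (le_div_iff₀ (by positivity)).1 (min_le_right _ _)
  obtain ⟨n, hn, w, hw1, hw2⟩ := (hP.and_eventually (hS (L f) (L x) η hη0)).exists
  have hnφ := norm_nonneg φ
  have hnφx := norm_nonneg (φ x)
  refine ⟨L + φ.smulRight (w - L f), ?_, n, hn, ?_⟩
  · rw [Metric.mem_ball, dist_eq_norm, add_sub_cancel_left,
      ContinuousLinearMap.norm_smulRight_apply]
    nlinarith [norm_nonneg (w - L f)]
  · have h1 : (L + φ.smulRight (w - L f)) f = w := by simp [hφ]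
    rw [h1, add_apply, ContinuousLinearMap.smulRight_apply, ← sub_sub]
    refine (norm_sub_le _ _).trans_lt ?_
    rw [norm_smul]
    nlinarith [norm_nonneg (w - L f)]

theorem isOpen_exists_return {𝕜 X : Type*} [RCLike 𝕜] [NormedAddCommGroup X]
    [NormedSpace 𝕜 X] (S : X →L[𝕜] X) (P : ℕ → Prop) (f x : X) (ε : ℝ) :
    IsOpen {L : X →L[𝕜] X | ∃ n, P n ∧ ‖(S ^ n) (L f) - L x‖ < ε} := by
  have : {L : X →L[𝕜] X | ∃ n, P n ∧ ‖(S ^ n) (L f) - L x‖ < ε} =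
      ⋃ n, ⋃ (_ : P n), {L : X →L[𝕜] X | ‖(S ^ n) (L f) - L x‖ < ε} := by
    ext; simp
  rw [this]
  refine isOpen_iUnion fun n => isOpen_iUnion fun _ => isOpen_lt ?_ continuous_const
  fun_prop

theorem unit_conj_pow {M : Type*} [Monoid M] (K : Mˣ) (S : M) (n : ℕ) :
    ((K⁻¹ : Mˣ) * S * K) ^ n = (K⁻¹ : Mˣ) * S ^ n * K := by
  simpa using (Units.conj_pow K⁻¹ S n)

/-- If, for every target in a dense sequence, the orbits of `f` under the `T i` and of `K f` under
`S` simultaneously approach the target and its image under `K`, then `f` is s-hypercyclic for the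
family `T` extended by `K⁻¹ S K`. -/
theorem mem_sHC_snoc_conj {𝕜 X : Type*} [RCLike 𝕜] [NormedAddCommGroup X]
    [NormedSpace 𝕜 X] {N : ℕ} {T : Fin N → X →L[𝕜] X} {f : X} {S : X →L[𝕜] X}
    (K : (X →L[𝕜] X)ˣ) {D : ℕ → X} (hD : DenseRange D)
    (h : ∀ k l : ℕ, ∃ n, (∀ i, ‖(T i ^ n) f - D k‖ < 1 / ((l : ℝ) + 1)) ∧
      ‖(S ^ n) ((K : X →L[𝕜] X) f) - (K : X →L[𝕜] X) (D k)‖ < 1 / ((l : ℝ) + 1)) :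
    f ∈ sHC (Fin.snoc T ((K⁻¹ : (X →L[𝕜] X)ˣ) * S * K) : Fin (N + 1) → X →L[𝕜] X) := by
  rintro _ ⟨x, rfl⟩
  rw [Metric.mem_closure_range_iff]
  intro ε hε
  obtain ⟨k, hk⟩ := hD.exists_dist_lt x (half_pos hε)
  set J : X →L[𝕜] X := ((K⁻¹ : (X →L[𝕜] X)ˣ) : X →L[𝕜] X) with hJ
  have hc0 : 0 < ‖J‖ + 1 := by positivity
  obtain ⟨l, hl⟩ := exists_nat_one_div_lt (show 0 < ε / 2 / (‖J‖ + 1) by positivity)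
  rw [lt_div_iff₀ hc0] at hl
  obtain ⟨n, hn1, hn2⟩ := h k l
  have hl0 : 0 < 1 / ((l : ℝ) + 1) := by positivity
  have hnJ := norm_nonneg J
  have key : ∀ z, ‖z - D k‖ < ε / 2 → dist x z < ε := by
    intro z hz
    rw [← dist_eq_norm, dist_comm] at hz
    linarith [dist_triangle x (D k) z]
  refine ⟨n, (dist_pi_lt_iff hε).2 fun i => ?_⟩
  induction i using Fin.lastCases with
  | cast i =>
    rw [Fin.snoc_castSucc]
    exact key _ (by nlinarith [hn1 i])
  | last =>
    rw [Fin.snoc_last, unit_conj_pow]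
    refine key _ ?_
    have hDk : D k = J ((K : X →L[𝕜] X) (D k)) := by
      rw [hJ, ← mul_apply_eq_comp, Units.inv_mul,
        one_apply_eq_self]
    rw [mul_apply_eq_comp, mul_apply_eq_comp]
    conv_lhs => rw [hDk, ← map_sub]
    refine (J.le_opNorm _).trans_lt ?_
    nlinarith [norm_nonneg ((S ^ n) ((K : X →L[𝕜] X) f) - (K : X →L[𝕜] X) (D k))]

theorem isSOTDense_of_forall_finite {𝕜 X : Type*} [NontriviallyNormedField 𝕜]
    [NormedAddCommGroup X] [NormedSpace 𝕜 X] {s : Set (X →L[𝕜] X)}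
    (h : ∀ (R : X →L[𝕜] X) (F : Set X), F.Finite → ∀ ε > 0, ∃ S ∈ s, ∀ x ∈ F, ‖S x - R x‖ < ε) :
    IsSOTDense s := by
  intro R
  rw [mem_closure_iff_nhds]
  intro V hV
  rw [(PointwiseConvergenceCLM.isEmbedding_coeFn (RingHom.id 𝕜) X X).nhds_eq_comap] at hV
  obtain ⟨W, hW, hWV⟩ := hV
  rw [nhds_pi, Filter.mem_pi] at hW
  obtain ⟨F, hF, t, ht, htW⟩ := hW
  have hev : ∀ᶠ ε in 𝓝[>] (0 : ℝ), ∀ x ∈ F, Metric.ball (R x) ε ⊆ t x := by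
    refine (eventually_all_finite hF).2 fun x _ => ?_
    obtain ⟨η, hη, hb⟩ := Metric.mem_nhds_iff.1 (ht x)
    filter_upwards [Ioo_mem_nhdsGT hη] with ε hε
    exact (Metric.ball_subset_ball hε.2.le).trans hb
  obtain ⟨ε, hε, hε0 : 0 < ε⟩ := (hev.and self_mem_nhdsWithin).exists
  obtain ⟨S, hS, hSR⟩ := h R F hF ε hε0
  refine ⟨_, hWV (htW fun x hx => hε x hx ?_), S, hS, rfl⟩
  rw [Metric.mem_ball, dist_eq_norm]
  exact hSR x hx

theorem corollary2p6 {𝕜 X : Type*} [RCLike 𝕜] [NormedAddCommGroup X] [NormedSpace 𝕜 X]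
    [CompleteSpace X] [TopologicalSpace.SeparableSpace X] (hX : ¬ FiniteDimensional 𝕜 X)
    (N : ℕ) (hN : 1 ≤ N) (T : Fin N → X →L[𝕜] X) (hT : IsSHypercyclic T)
    (A : Set X) (hA : A ⊆ sHC T) (hAc : A.Countable)
    (hAi : LinearIndependent 𝕜 ((↑) : A → X)) :
    IsSOTDense {S : X →L[𝕜] X | A ⊆ sHC (Fin.snoc T S : Fin (N + 1) → X →L[𝕜] X)} := by
  refine isSOTDense_of_forall_finite ?_
  intro R F hF ε hε
  have : Nontrivial X := by
    by_contra h
    rw [not_nontrivial_iff_subsingleton] at h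
    exact hX inferInstance
  have : Countable A := hAc.to_subtype
  obtain ⟨Φ, S, hΦinj, hΦd, hS⟩ := exists_clm_translation (𝕜 := 𝕜) hX
  have hmix := isMixing_of_translation hΦd hS
  obtain ⟨u, hu⟩ := linearIndependent_fwdDiff_translation hΦinj hS
  obtain ⟨K₀, hK₀⟩ := exists_conj_norm_sub_lt hX hu R hF hε
  let D := TopologicalSpace.denseSeq X
  have hdense := dense_iInter_of_isOpen
    (fun q : A × ℕ × ℕ => isOpen_exists_return S
      (fun n => ∀ i, ‖(T i ^ n) (q.1 : X) - D q.2.1‖ < 1 / ((q.2.2 : ℝ) + 1)) q.1 (D q.2.1)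
        (1 / ((q.2.2 : ℝ) + 1)))
    (fun q => dense_exists_return_of_isMixing hmix
      (sHC_frequently_return hN (hA q.1.2) (D q.2.1) (by positivity)) (hAi.ne_zero q.1)
        (D q.2.1) (by positivity))
  let L₀ : (X →L[𝕜] X)ˣ := K₀⁻¹
  -- `Ring.inverse` is total and continuous at units, so conjugation makes sense on the whole Banach
  -- algebra, where Baire applies; invertibility of `L` follows later from closeness to `L₀`.
  have hcont : ContinuousAt (fun L : X →L[𝕜] X => Ring.inverse L * S * L) L₀ :=
    ((NormedRing.inverse_continuousAt L₀).mul continuousAt_const).mul continuousAt_id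
  have hnear : ∀ᶠ L in 𝓝 (L₀ : X →L[𝕜] X), ∀ x ∈ F, ‖(Ring.inverse L * S * L) x - R x‖ < ε := by
    refine (eventually_all_finite hF).2 fun x hx => ?_
    have hc : ContinuousAt (fun L : X →L[𝕜] X => ‖(Ring.inverse L * S * L) x - R x‖) L₀ :=
      ((hcont.clm_apply continuousAt_const).sub continuousAt_const).norm
    refine hc.eventually_lt continuousAt_const ?_
    simpa [L₀] using hK₀ x hx
  obtain ⟨_, hL, hLF, ⟨L, rfl⟩⟩ := hdense.inter_nhds_nonempty
    (hnear.and (Units.nhds L₀))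
  rw [Set.mem_iInter] at hL
  rw [Ring.inverse_unit] at hLF
  exact ⟨_, fun f hf => mem_sHC_snoc_conj L (TopologicalSpace.denseRange_denseSeq X)
    fun k l => hL (⟨f, hf⟩, k, l), hLF⟩
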